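/- Let $d\ge 2$, let $\mathbb{S}^d$ be the unit sphere in $\mathbb{R}^{d+1}$, let $\mathrm{Vol}_{\mathbb{S}^d}$ be the spherical Lebesgue measure on $\mathbb{S}^d$, and let $\mathbb{S}^d_+=\{x\in\mathbb{S}^d : x_{d+1}>0\}$ be the open upper hemisphere. A set $A\subseteq\mathbb{S}^d$ is called spherically convex if the cone $\{ta : t\ge 0,\ a\in A\}$ is convex in $\mathbb{R}^{d+1}$. The spherical convex hull of a set of points is the smallest spherically convex set that contains it. For $n\ge d+1$ let $\widehat X_1,\dots,\widehat X_n$ be independent random points, each distributed uniformly (with respect to $\mathrm{Vol}_{\mathbb{S}^d}$) in $\mathbb{S}^d_+$, and let $\widehat K_n^0$ be their spherical convex hull. Then there is a constant $\gamma>0$, depending only on $d$, such that for every $n\ge d+1$ the random variable $\mathrm{Vol}_{\mathbb{S}^d}(\widehat K_n^0)$ is square integrable and $$\mathrm{Var}\,\mathrm{Vol}_{\mathbb{S}^d}(\widehat K_n^0)\ \ge\ \gamma\, n^{-2}.$$ -/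

import Mathlib

open MeasureTheory ProbabilityTheory

noncomputable section

/-- The unit sphere `𝕊^d` of `ℝ^(d+1)`. -/
abbrev UnitSphere (d : ℕ) : Type :=
  Metric.sphere (0 : EuclideanSpace ℝ (Fin (d + 1))) 1

/-- The spherical Lebesgue measure on `𝕊^d` (surface area): the measure of `A` is `d + 1` times
the Lebesgue measure of the truncated cone `{t • a | 0 < t < 1, a ∈ A}`. -/
def sphereVol (d : ℕ) : Measure (UnitSphere d) :=
  (volume : Measure (EuclideanSpace ℝ (Fin (d + 1)))).toSphere

/-- The open upper hemisphere: the points of `𝕊^d` whose last coordinate is positive. -/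
def upperHemisphere (d : ℕ) : Set (UnitSphere d) :=
  {x | 0 < (x : EuclideanSpace ℝ (Fin (d + 1))) (Fin.last d)}

/-- The union of the rays from the origin through the points of `A`. -/
def radialCone {d : ℕ} (A : Set (UnitSphere d)) : Set (EuclideanSpace ℝ (Fin (d + 1))) :=
  {v | ∃ t : ℝ, 0 ≤ t ∧ ∃ a ∈ A, v = t • (a : EuclideanSpace ℝ (Fin (d + 1)))}

/-- `A ⊆ 𝕊^d` is spherically convex if the cone that it spans is convex; equivalently, `A`
contains the shortest geodesic arc between any two of its points that are not antipodal. -/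
def SphericallyConvex {d : ℕ} (A : Set (UnitSphere d)) : Prop :=
  Convex ℝ (radialCone A)

/-- The spherical convex hull: the smallest spherically convex set that contains `A`. -/
def sphericalHull {d : ℕ} (A : Set (UnitSphere d)) : Set (UnitSphere d) :=
  ⋂₀ {C | SphericallyConvex C ∧ A ⊆ C}

end

/-!
The hull typically loses volume only near the equator, on the scale `1 / n`, and this fluctuates on the
same scale: there are two events, each of probability bounded below independently of `n`, on which
the volumes of the hull are separated by a gap of order `1 / n`. The variance is then at least of
order `n⁻²` (`mul_sq_div_four_le_variance`).

On the first event no point has height below `δ / n` (`half_le_measureReal_forall_le_last`). Caps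
around the pole that lie in the hemisphere are spherically convex, so the hull misses the whole band
of height `δ / n` (`le_last_of_mem_sphericalHull`), whose volume is at least `c δ / n`.

On the second event each of `d + 1` regions of height `ε / n` above the equator, placed around the
directions of the vertices of a simplex in `ℝ^d` with `0` in its interior, contains one of the
points (`pow_le_measureReal_forall_exists_mem_vertexRegion`). Every simplex with nearby vertices
contains a fixed cube (`exists_stdSimplex_sum_eq`), so the cone over the points contains every
direction of height at least a constant multiple of `ε / n` (`mem_sphericalHull_of_vertexRegion`),
and the volume lost is at most a constant multiple of `ε / n`. Taking `ε` small compared with `δ`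
separates the two events.
-/

/-! ### Finite spherical hulls as conic combinations -/

lemma mem_of_mem_radialCone {d : ℕ} {A : Set (UnitSphere d)} {x : UnitSphere d}
    (hx : (x : EuclideanSpace ℝ (Fin (d + 1))) ∈ radialCone A) : x ∈ A := by
  obtain ⟨t, ht, a, ha, hxa⟩ := hx
  have h1 : ‖(x : EuclideanSpace ℝ (Fin (d + 1)))‖ = 1 := by simp
  have h2 : t = 1 := by
    rw [hxa, norm_smul] at h1
    simpa [abs_of_nonneg ht] using h1
  rw [h2, one_smul] at hxa
  rwa [Subtype.ext hxa]

lemma add_mem_radialCone {d : ℕ} {A : Set (UnitSphere d)} (hA : SphericallyConvex A)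
    {v w : EuclideanSpace ℝ (Fin (d + 1))} (hv : v ∈ radialCone A) (hw : w ∈ radialCone A) :
    v + w ∈ radialCone A := by
  obtain ⟨t, ht, a, ha, h⟩ := hA hv hw (a := 1 / 2) (b := 1 / 2) (by norm_num) (by norm_num)
    (by norm_num)
  refine ⟨2 * t, by positivity, a, ha, ?_⟩
  rw [mul_smul, ← h]
  module

/-- The spherical convex hull of finitely many points consists of the unit vectors that are
nonnegative linear combinations of them. -/
lemma mem_sphericalHull_range_iff {d : ℕ} {ι : Type*} [Fintype ι] [Nonempty ι]
    (y : ι → UnitSphere d) (x : UnitSphere d) :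
    x ∈ sphericalHull (Set.range y) ↔
      ∃ t : ι → ℝ, (∀ i, 0 ≤ t i) ∧
        (x : EuclideanSpace ℝ (Fin (d + 1))) = ∑ i, t i • (y i : EuclideanSpace ℝ (Fin (d + 1))) := by
  constructor
  · intro hx
    refine Set.mem_sInter.1 hx {x : UnitSphere d | ∃ t : ι → ℝ, (∀ i, 0 ≤ t i) ∧
        (x : EuclideanSpace ℝ (Fin (d + 1))) = ∑ i, t i • (y i : EuclideanSpace ℝ (Fin (d + 1)))}
      ⟨?_, ?_⟩
    · have key : radialCone {x : UnitSphere d | ∃ t : ι → ℝ, (∀ i, 0 ≤ t i) ∧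
          (x : EuclideanSpace ℝ (Fin (d + 1))) =
            ∑ i, t i • (y i : EuclideanSpace ℝ (Fin (d + 1)))} =
          {v | ∃ t : ι → ℝ, (∀ i, 0 ≤ t i) ∧
            v = ∑ i, t i • (y i : EuclideanSpace ℝ (Fin (d + 1)))} := by
        ext v
        constructor
        · rintro ⟨s, hs, a, ⟨t, ht, ha⟩, rfl⟩
          refine ⟨fun i => s * t i, fun i => mul_nonneg hs (ht i), ?_⟩
          rw [ha, Finset.smul_sum]
          simp only [mul_smul]
        · rintro ⟨t, ht, rfl⟩
          set v := ∑ i, t i • (y i : EuclideanSpace ℝ (Fin (d + 1))) with hv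
          by_cases h0 : v = 0
          · obtain ⟨i₀⟩ := ‹Nonempty ι›
            classical
            refine ⟨0, le_rfl, y i₀, ⟨Pi.single i₀ 1, fun i => ?_, ?_⟩, by simp [h0]⟩
            · by_cases h : i = i₀
              · subst h; simp
              · simp [h]
            · simp [Pi.single_apply]
          · have h1 : ‖v‖ ≠ 0 := norm_ne_zero_iff.2 h0
            refine ⟨‖v‖, norm_nonneg _, ⟨‖v‖⁻¹ • v, by simp [norm_smul, h1]⟩,
              ⟨fun i => ‖v‖⁻¹ * t i, fun i => mul_nonneg (by positivity) (ht i), ?_⟩, ?_⟩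
            · simp only [mul_smul, ← Finset.smul_sum]
              rw [← hv]
            · simp [smul_smul, h1]
      rw [SphericallyConvex, key]
      rintro _ ⟨t, ht, rfl⟩ _ ⟨t', ht', rfl⟩ a b ha hb -
      refine ⟨fun i => a * t i + b * t' i, fun i => ?_, ?_⟩
      · have := ht i; have := ht' i; positivity
      · simp only [add_smul, mul_smul, Finset.sum_add_distrib, Finset.smul_sum]
    · rintro _ ⟨i₀, rfl⟩
      classical
      refine ⟨Pi.single i₀ 1, fun i => ?_, ?_⟩
      · by_cases h : i = i₀
        · subst h; simp
        · simp [h]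
      · simp [Pi.single_apply]
  · rintro ⟨t, ht, hx⟩ C ⟨hC, hy⟩
    refine mem_of_mem_radialCone ?_
    rw [hx]
    have hyC : ∀ i, ∀ s : ℝ, 0 ≤ s → s • (y i : EuclideanSpace ℝ (Fin (d + 1))) ∈ radialCone C :=
      fun i s hs => ⟨s, hs, y i, hy ⟨i, rfl⟩, rfl⟩
    refine Finset.sum_induction _ (· ∈ radialCone C) (fun _ _ => add_mem_radialCone hC) ?_
      fun i _ => hyC i _ (ht i)
    simpa using hyC (Classical.arbitrary ι) 0 le_rfl

/-- If all points lie at height at least `s`, so does their spherical convex hull. -/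
lemma le_last_of_mem_sphericalHull {d : ℕ} {ι : Type*} [Fintype ι] [Nonempty ι]
    {y : ι → UnitSphere d} {s : ℝ} (hs : 0 ≤ s)
    (hy : ∀ i, s ≤ (y i : EuclideanSpace ℝ (Fin (d + 1))) (Fin.last d)) {x : UnitSphere d}
    (hx : x ∈ sphericalHull (Set.range y)) :
    s ≤ (x : EuclideanSpace ℝ (Fin (d + 1))) (Fin.last d) := by
  obtain ⟨t, ht, hxt⟩ := (mem_sphericalHull_range_iff y x).1 hx
  have h1 : 1 ≤ ∑ i, t i := by
    calc (1 : ℝ) = ‖(x : EuclideanSpace ℝ (Fin (d + 1)))‖ := by simp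
      _ ≤ ∑ i, ‖t i • (y i : EuclideanSpace ℝ (Fin (d + 1)))‖ := hxt ▸ norm_sum_le _ _
      _ = ∑ i, t i := Finset.sum_congr rfl fun i _ => by
        rw [norm_smul]; simp [abs_of_nonneg (ht i)]
  calc s ≤ (∑ i, t i) * s := le_mul_of_one_le_left hs h1
    _ = ∑ i, t i * s := Finset.sum_mul ..
    _ ≤ ∑ i, t i * (y i : EuclideanSpace ℝ (Fin (d + 1))) (Fin.last d) :=
      Finset.sum_le_sum fun i _ => mul_le_mul_of_nonneg_left (hy i) (ht i)
    _ = _ := by rw [hxt]; simp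

/-! ### Points near the vertices of a simplex in the equator -/

/-- The vertices `e₁, …, e_d, -(e₁ + ⋯ + e_d)` of a simplex in `ℝ^d` with barycentre `0`. -/
def simplexVertex (d : ℕ) : Fin (d + 1) → Fin d → ℝ :=
  Fin.snoc (α := fun _ => Fin d → ℝ) (fun k => Pi.single k 1) (-1)

/-- The radius of the cube around the origin that stays inside the simplex when each of its
vertices moves by at most the same amount in every coordinate. -/
noncomputable def simplexRadius (d : ℕ) : ℝ := (2 * (2 * d + 1))⁻¹

lemma simplexRadius_pos (d : ℕ) : 0 < simplexRadius d := by
  unfold simplexRadius; positivity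

lemma simplexRadius_le_half (d : ℕ) : simplexRadius d ≤ 1 / 2 := by
  unfold simplexRadius
  rw [one_div]
  gcongr
  have : (0 : ℝ) ≤ d := by positivity
  linarith

lemma abs_simplexVertex_le_one (d : ℕ) (j : Fin (d + 1)) (k : Fin d) :
    |simplexVertex d j k| ≤ 1 := by
  unfold simplexVertex
  refine Fin.lastCases ?_ (fun i => ?_) j
  · simp
  · simp only [Fin.snoc_castSucc, Pi.single_apply]
    split_ifs <;> simp

/-- A simplex whose vertices are close to those of `simplexVertex` contains a fixed cube around
the origin. Otherwise a linear functional separates a point of the cube from the simplex. Its values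
at all the vertices `e₁, …, e_d, -(e₁ + ⋯ + e_d)` are less than a small multiple of the sum `F` of the
absolute values of its coefficients, and this gives `F < F`. -/
lemma exists_stdSimplex_sum_eq {d : ℕ} {w : Fin (d + 1) → Fin d → ℝ}
    (hw : ∀ j k, |w j k - simplexVertex d j k| < simplexRadius d) {y : Fin d → ℝ}
    (hy : ∀ k, |y k| ≤ simplexRadius d) :
    ∃ t ∈ stdSimplex ℝ (Fin (d + 1)), ∑ j, t j • w j = y := by
  by_contra hcon
  set L : (Fin (d + 1) → ℝ) →ₗ[ℝ] (Fin d → ℝ) := Fintype.linearCombination ℝ w with hL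
  have hLa : ∀ t, L t = ∑ j, t j • w j := fun t => Fintype.linearCombination_apply ..
  have hcomp : IsCompact (L '' stdSimplex ℝ (Fin (d + 1))) :=
    (isCompact_stdSimplex ℝ _).image L.continuous_of_finiteDimensional
  have hyK : y ∉ L '' stdSimplex ℝ (Fin (d + 1)) := by
    rintro ⟨t, ht, h⟩
    exact hcon ⟨t, ht, by rw [← hLa, h]⟩
  obtain ⟨f, u, hf, hfy⟩ := geometric_hahn_banach_closed_point
    ((convex_stdSimplex ℝ _).linear_image L) hcomp.isClosed hyK
  set c : Fin d → ℝ := fun k => f (Pi.single k 1) with hc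
  have hfc : ∀ x, f x = ∑ k, x k * c k := fun x => by
    conv_lhs => rw [pi_eq_sum_univ' x]
    rw [map_sum]
    refine Finset.sum_congr rfl fun k _ => ?_
    rw [map_smul, smul_eq_mul, hc]
  set F : ℝ := ∑ k, |c k| with hF
  have hbound : ∀ z : Fin d → ℝ, (∀ k, |z k| ≤ simplexRadius d) → |f z| ≤ simplexRadius d * F := by
    intro z hz
    rw [hfc, hF, Finset.mul_sum]
    refine (Finset.abs_sum_le_sum_abs _ _).trans (Finset.sum_le_sum fun k _ => ?_)
    rw [abs_mul]
    exact mul_le_mul_of_nonneg_right (hz k) (abs_nonneg _)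
  -- At every `w j` the functional is smaller than at `y`; this bounds it above at the exact vertices.
  have hvert : ∀ j, f (simplexVertex d j) < 2 * simplexRadius d * F := by
    intro j
    have h1 : f (w j) < u := by
      refine hf _ ⟨Pi.single j 1, single_mem_stdSimplex ℝ j, ?_⟩
      rw [hL, Fintype.linearCombination_apply_single, one_smul]
    have h2 := (abs_le.1 (hbound (w j - simplexVertex d j) fun k => (hw j k).le)).1
    have h3 := (abs_le.1 (hbound y hy)).2
    rw [map_sub] at h2
    linarith
  have hck : ∀ k, c k ≤ 2 * simplexRadius d * F := fun k => by
    have := hvert k.castSucc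
    simp only [simplexVertex, Fin.snoc_castSucc] at this
    exact this.le
  have hsum : -∑ k, c k < 2 * simplexRadius d * F := by
    have := hvert (Fin.last d)
    rw [hfc] at this
    simpa [simplexVertex] using this
  have hF0 : 0 ≤ F := Finset.sum_nonneg fun k _ => abs_nonneg _
  have hη : 0 ≤ 2 * simplexRadius d * F :=
    mul_nonneg (mul_nonneg (by norm_num) (simplexRadius_pos d).le) hF0
  have habs : F ≤ ∑ k : Fin d, (2 * (2 * simplexRadius d * F) - c k) :=
    Finset.sum_le_sum fun k _ => by
      rcases abs_cases (c k) with h | h <;> linarith [hck k, h.1]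
  rw [Finset.sum_sub_distrib] at habs
  simp only [Finset.sum_const, Finset.card_univ, Fintype.card_fin, nsmul_eq_mul] at habs
  have hr : (2 * d + 1) * (2 * simplexRadius d) = 1 := by
    unfold simplexRadius
    field_simp
  have : (2 * d + 1) * (2 * simplexRadius d) * F = F := by rw [hr, one_mul]
  linarith

/-- The box of height `s` over the cube around the `j`-th vertex of the simplex. -/
def vertexBox (d : ℕ) (j : Fin (d + 1)) (s : ℝ) : Set (EuclideanSpace ℝ (Fin (d + 1))) :=
  {v | (∀ k : Fin d, |v k.castSucc - simplexVertex d j k| < simplexRadius d) ∧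
    0 < v (Fin.last d) ∧ v (Fin.last d) < s}

/-- The points of the sphere whose rays meet `vertexBox d j s`. For small `s` they lie just above
the equator, in directions close to the `j`-th vertex of the simplex. -/
def vertexRegion (d : ℕ) (j : Fin (d + 1)) (s : ℝ) : Set (UnitSphere d) :=
  {x | ∃ t : ℝ, 0 < t ∧ t • (x : EuclideanSpace ℝ (Fin (d + 1))) ∈ vertexBox d j s}

/-- If every region near a vertex of the simplex contains one of the points, then their spherical
convex hull contains all points of height at least `s / simplexRadius d`. -/
lemma mem_sphericalHull_of_vertexRegion {d : ℕ} {ι : Type*} [Fintype ι] [Nonempty ι]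
    {y : ι → UnitSphere d} {s : ℝ} (hy : ∀ j, ∃ i, y i ∈ vertexRegion d j s)
    {x : UnitSphere d}
    (hx : s / simplexRadius d ≤ (x : EuclideanSpace ℝ (Fin (d + 1))) (Fin.last d)) :
    x ∈ sphericalHull (Set.range y) := by
  have hρ := simplexRadius_pos d
  choose i τ hτ hbox using hy
  set z : Fin (d + 1) → EuclideanSpace ℝ (Fin (d + 1)) :=
    fun j => τ j • (y (i j) : EuclideanSpace ℝ (Fin (d + 1))) with hz
  have hw : ∀ j k, |(fun k : Fin d => z j k.castSucc) k - simplexVertex d j k| < simplexRadius d :=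
    fun j k => (hbox j).1 k
  obtain ⟨a, ha, hasum⟩ := exists_stdSimplex_sum_eq hw
    (y := fun k => simplexRadius d * (x : EuclideanSpace ℝ (Fin (d + 1))) k.castSucc) fun k => by
      rw [abs_mul, abs_of_pos hρ]
      refine mul_le_of_le_one_right hρ.le ?_
      have := PiLp.norm_apply_le (x : EuclideanSpace ℝ (Fin (d + 1))) k.castSucc
      simpa using this
  obtain ⟨b, hb, hbsum⟩ := exists_stdSimplex_sum_eq hw (y := 0) fun k => by simpa using hρ.le
  set H := ∑ j, b j * z j (Fin.last d) with hH
  have hHpos : 0 < H := by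
    obtain ⟨j, -, hj⟩ : ∃ j ∈ Finset.univ, 0 < b j := by
      apply Finset.exists_lt_of_sum_lt
      simp [hb.2]
    exact Finset.sum_pos' (fun j _ => mul_nonneg (hb.1 j) (hbox j).2.1.le)
      ⟨j, Finset.mem_univ _, mul_pos hj (hbox j).2.1⟩
  set A := ∑ j, a j * z j (Fin.last d) with hA
  have hAs : A ≤ s := by
    calc A ≤ ∑ j, a j * s :=
          Finset.sum_le_sum fun j _ => mul_le_mul_of_nonneg_left (hbox j).2.2.le (ha.1 j)
      _ = s := by rw [← Finset.sum_mul, ha.2, one_mul]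
  -- `a` produces the horizontal part of `x` below `x`, and a multiple of `b` lifts it to `x`.
  set lift := ((x : EuclideanSpace ℝ (Fin (d + 1))) (Fin.last d) - A / simplexRadius d) / H
    with hlift
  have hlift0 : 0 ≤ lift := by
    refine div_nonneg (sub_nonneg.2 (le_trans ?_ hx)) hHpos.le
    gcongr
  have hxz : (x : EuclideanSpace ℝ (Fin (d + 1))) =
      ∑ j, (a j / simplexRadius d + lift * b j) • z j := by
    ext k
    have hsum : (∑ j, (a j / simplexRadius d + lift * b j) • z j) k =
        (∑ j, a j * z j k) / simplexRadius d + lift * ∑ j, b j * z j k := by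
      simp only [PiLp.smul_apply, WithLp.ofLp_sum, Finset.sum_apply, smul_eq_mul, Finset.mul_sum,
        Finset.sum_div, ← Finset.sum_add_distrib]
      exact Finset.sum_congr rfl fun j _ => by ring
    rw [hsum]
    refine Fin.lastCases ?_ (fun k => ?_) k
    · rw [← hA, ← hH, hlift]
      field_simp
      ring
    · have h1 := congrFun hasum k
      have h2 := congrFun hbsum k
      simp only [Finset.sum_apply, Pi.smul_apply, smul_eq_mul, Pi.zero_apply] at h1 h2
      rw [h1, h2]
      field_simp
      ring
  rw [mem_sphericalHull_range_iff]
  classical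
  refine ⟨fun l => ∑ j with i j = l, (a j / simplexRadius d + lift * b j) * τ j,
    fun l => Finset.sum_nonneg fun j _ => ?_, ?_⟩
  · have := ha.1 j; have := hb.1 j; have := hτ j
    positivity
  · rw [hxz]
    simp only [Finset.sum_smul]
    rw [← Finset.sum_fiberwise Finset.univ i]
    refine Finset.sum_congr rfl fun l _ => Finset.sum_congr rfl fun j hj => ?_
    rw [← (Finset.mem_filter.1 hj).2, hz, smul_smul]

/-! ### Volumes of regions near the equator -/

instance (d : ℕ) : IsFiniteMeasure (sphereVol d) := by
  unfold sphereVol; infer_instance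

lemma continuous_unitSphere_apply {d : ℕ} (k : Fin (d + 1)) :
    Continuous fun x : UnitSphere d => (x : EuclideanSpace ℝ (Fin (d + 1))) k := by
  fun_prop

lemma isOpen_upperHemisphere (d : ℕ) : IsOpen (upperHemisphere d) :=
  isOpen_lt continuous_const (continuous_unitSphere_apply _)

/-- The part of the upper hemisphere below height `s`. -/
def lowerBand (d : ℕ) (s : ℝ) : Set (UnitSphere d) :=
  {x | 0 < (x : EuclideanSpace ℝ (Fin (d + 1))) (Fin.last d) ∧
    (x : EuclideanSpace ℝ (Fin (d + 1))) (Fin.last d) < s}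

lemma isOpen_lowerBand (d : ℕ) (s : ℝ) : IsOpen (lowerBand d s) :=
  (isOpen_lt continuous_const (continuous_unitSphere_apply _)).inter
    (isOpen_lt (continuous_unitSphere_apply _) continuous_const)

lemma lowerBand_subset (d : ℕ) (s : ℝ) : lowerBand d s ⊆ upperHemisphere d := fun _ hx => hx.1

lemma isOpen_vertexBox (d : ℕ) (j : Fin (d + 1)) (s : ℝ) : IsOpen (vertexBox d j s) := by
  have h : vertexBox d j s =
      (⋂ k : Fin d, {v : EuclideanSpace ℝ (Fin (d + 1)) |
        |v k.castSucc - simplexVertex d j k| < simplexRadius d}) ∩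
      ({v | 0 < v (Fin.last d)} ∩ {v | v (Fin.last d) < s}) := by
    ext v; simp [vertexBox]
  rw [h]
  refine (isOpen_iInter_of_finite fun k => ?_).inter (IsOpen.inter ?_ ?_)
  · exact isOpen_lt (by fun_prop) continuous_const
  · exact isOpen_lt continuous_const (by fun_prop)
  · exact isOpen_lt (by fun_prop) continuous_const

lemma isOpen_vertexRegion (d : ℕ) (j : Fin (d + 1)) (s : ℝ) : IsOpen (vertexRegion d j s) := by
  have h : vertexRegion d j s = ⋃ t : ℝ, ⋃ _ : 0 < t,
      {x : UnitSphere d | t • (x : EuclideanSpace ℝ (Fin (d + 1))) ∈ vertexBox d j s} := by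
    ext x; simp [vertexRegion]
  rw [h]
  exact isOpen_iUnion fun t => isOpen_iUnion fun _ =>
    (isOpen_vertexBox d j s).preimage
      (f := fun x : UnitSphere d => t • (x : EuclideanSpace ℝ (Fin (d + 1)))) (by fun_prop)

lemma vertexRegion_subset (d : ℕ) (j : Fin (d + 1)) (s : ℝ) :
    vertexRegion d j s ⊆ upperHemisphere d := by
  rintro x ⟨t, ht, -, h, -⟩
  simpa [upperHemisphere, ht] using h

section Volume

open scoped Pointwise

lemma volume_vertexBox (d : ℕ) (j : Fin (d + 1)) (s : ℝ) :
    volume (vertexBox d j s) = ENNReal.ofReal ((2 * simplexRadius d) ^ d * s) := by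
  have hρ := simplexRadius_pos d
  have h : vertexBox d j s = (WithLp.ofLp : EuclideanSpace ℝ (Fin (d + 1)) → _) ⁻¹'
      Set.pi Set.univ fun k => Set.Ioo
        (Fin.snoc (α := fun _ => ℝ) (fun k => simplexVertex d j k - simplexRadius d) 0 k)
        (Fin.snoc (α := fun _ => ℝ) (fun k => simplexVertex d j k + simplexRadius d) s k) := by
    ext v
    simp only [vertexBox, Set.mem_ofPred_eq, Set.mem_preimage, Set.mem_pi, Set.mem_univ, true_imp_iff,
      Fin.forall_fin_succ', Fin.snoc_castSucc, Fin.snoc_last, Set.mem_Ioo]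
    refine and_congr (forall_congr' fun k => ?_) Iff.rfl
    rw [abs_lt]
    constructor <;> rintro ⟨h1, h2⟩ <;> constructor <;> linarith
  rw [h, (PiLp.volume_preserving_ofLp (Fin (d + 1))).measure_preimage
    (MeasurableSet.univ_pi fun k => measurableSet_Ioo).nullMeasurableSet, Real.volume_pi_Ioo,
    Fin.prod_univ_castSucc]
  simp only [Fin.snoc_castSucc, Fin.snoc_last, sub_zero]
  rw [ENNReal.ofReal_mul (by positivity), ENNReal.ofReal_pow (by positivity)]
  congr 1
  rw [Finset.prod_congr rfl fun k _ => (by ring_nf :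
    ENNReal.ofReal (simplexVertex d j k + simplexRadius d - (simplexVertex d j k - simplexRadius d))
      = ENNReal.ofReal (2 * simplexRadius d))]
  simp

lemma norm_lt_of_mem_vertexBox {d : ℕ} {j : Fin (d + 1)} {s : ℝ} (hs : s ≤ 1)
    {v : EuclideanSpace ℝ (Fin (d + 1))} (hv : v ∈ vertexBox d j s) : ‖v‖ < 2 * (d + 1) + 1 := by
  have hk : ∀ k, ‖v k‖ ≤ 2 := by
    refine fun k => Fin.lastCases ?_ (fun k => ?_) k
    · rw [Real.norm_eq_abs, abs_of_pos hv.2.1]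
      linarith [hv.2.2]
    · have h1 := hv.1 k
      have h2 := abs_simplexVertex_le_one d j k
      have h3 := simplexRadius_le_half d
      rw [Real.norm_eq_abs]
      rw [abs_lt] at h1
      rw [abs_le] at h2 ⊢
      constructor <;> linarith
  have h1 : ‖v‖ ^ 2 ≤ (2 * (d + 1)) ^ 2 := by
    rw [EuclideanSpace.norm_sq_eq]
    calc ∑ k, ‖v k‖ ^ 2 ≤ ∑ _k : Fin (d + 1), (2 : ℝ) ^ 2 :=
          Finset.sum_le_sum fun k _ => pow_le_pow_left₀ (norm_nonneg _) (hk k) 2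
      _ = (d + 1) * 4 := by norm_num
      _ ≤ _ := by nlinarith [(Nat.cast_nonneg d : (0 : ℝ) ≤ d)]
  have := abs_le_of_sq_le_sq h1 (by positivity)
  rw [abs_le] at this
  linarith [this.2]

/-- Each region near a vertex has volume at least proportional to its height. -/
lemma exists_le_sphereVol_vertexRegion (d : ℕ) :
    ∃ c : ℝ, 0 < c ∧ ∀ j, ∀ s : ℝ, 0 ≤ s → s ≤ 1 →
      c * s ≤ (sphereVol d).real (vertexRegion d j s) := by
  have hρ := simplexRadius_pos d
  set B : ℝ := 2 * (d + 1) + 1 with hB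
  have hBpos : 0 < B := by positivity
  refine ⟨(d + 1 : ℕ) * ((B⁻¹) ^ (d + 1) * (2 * simplexRadius d) ^ d), by positivity,
    fun j s hs hs1 => ?_⟩
  -- The shrunken box lies in the truncated cone over the region.
  have hsub : B⁻¹ • vertexBox d j s ⊆
      Set.Ioo (0 : ℝ) 1 • ((↑) '' vertexRegion d j s : Set (EuclideanSpace ℝ (Fin (d + 1)))) := by
    rintro _ ⟨v, hv, rfl⟩
    have hv0 : v ≠ 0 := by
      rintro rfl
      simpa using hv.2.1
    have hn : ‖v‖ ≠ 0 := norm_ne_zero_iff.2 hv0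
    refine ⟨B⁻¹ * ‖v‖, ⟨by positivity, ?_⟩, ‖v‖⁻¹ • v,
      ⟨⟨‖v‖⁻¹ • v, by simp [norm_smul, hn]⟩, ⟨‖v‖, by positivity, ?_⟩, rfl⟩, ?_⟩
    · rw [inv_mul_lt_one₀ hBpos]
      exact norm_lt_of_mem_vertexBox hs1 hv
    · simpa [smul_smul, hn] using hv
    · simp [smul_smul, hn]
  have h1 : volume (B⁻¹ • vertexBox d j s) =
      ENNReal.ofReal ((B⁻¹) ^ (d + 1) * ((2 * simplexRadius d) ^ d * s)) := by
    rw [Measure.addHaar_smul, volume_vertexBox d j s, ← ENNReal.ofReal_mul (by positivity)]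
    simp only [finrank_euclideanSpace, Fintype.card_fin]
    rw [abs_of_nonneg (by positivity)]
  have h2 : ENNReal.ofReal ((d + 1 : ℕ) * ((B⁻¹) ^ (d + 1) * (2 * simplexRadius d) ^ d) * s) ≤
      sphereVol d (vertexRegion d j s) := by
    rw [sphereVol, Measure.toSphere_apply' _ (isOpen_vertexRegion d j s).measurableSet]
    refine le_trans (le_of_eq ?_) (mul_le_mul_right (h1 ▸ measure_mono hsub) _)
    rw [finrank_euclideanSpace, Fintype.card_fin, ← ENNReal.ofReal_natCast,
      ← ENNReal.ofReal_mul (by positivity)]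
    congr 1
    ring
  exact (ENNReal.ofReal_le_iff_le_toReal (measure_ne_top _ _)).1 h2

/-- The volume of the band of height `s` is at most proportional to `s`. -/
lemma exists_sphereVol_lowerBand_le (d : ℕ) :
    ∃ C : ℝ, 0 < C ∧ ∀ s : ℝ, 0 ≤ s → (sphereVol d).real (lowerBand d s) ≤ C * s := by
  refine ⟨(d + 1 : ℕ) * 2 ^ d, by positivity, fun s hs => ?_⟩
  have hsub : Set.Ioo (0 : ℝ) 1 • ((↑) '' lowerBand d s : Set (EuclideanSpace ℝ (Fin (d + 1)))) ⊆
      (WithLp.ofLp : EuclideanSpace ℝ (Fin (d + 1)) → _) ⁻¹'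
      Set.pi Set.univ fun k => Set.Ioo
        (Fin.snoc (α := fun _ => ℝ) (fun _ : Fin d => -1) 0 k)
        (Fin.snoc (α := fun _ => ℝ) (fun _ : Fin d => 1) s k) := by
    rintro _ ⟨t, ht, _, ⟨x, hx, rfl⟩, rfl⟩
    simp only [Set.mem_preimage, Set.mem_pi, Set.mem_univ, true_imp_iff,
      Fin.forall_fin_succ', Fin.snoc_castSucc, Fin.snoc_last]
    refine ⟨fun k => ?_, ?_⟩
    · have h1 : |(x : EuclideanSpace ℝ (Fin (d + 1))) k.castSucc| ≤ 1 := by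
        simpa using PiLp.norm_apply_le (x : EuclideanSpace ℝ (Fin (d + 1))) k.castSucc
      rw [Set.mem_Ioo, ← abs_lt]
      simp only [PiLp.smul_apply, smul_eq_mul, abs_mul, abs_of_pos ht.1]
      exact (mul_le_of_le_one_right ht.1.le h1).trans_lt ht.2
    · simp only [PiLp.smul_apply, smul_eq_mul]
      exact ⟨mul_pos ht.1 hx.1, (mul_lt_of_lt_one_left hx.1 ht.2).trans hx.2⟩
  have h2 : sphereVol d (lowerBand d s) ≤ ENNReal.ofReal ((d + 1 : ℕ) * 2 ^ d * s) := by
    rw [sphereVol, Measure.toSphere_apply' _ (isOpen_lowerBand d s).measurableSet]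
    refine (mul_le_mul_right (measure_mono hsub) _).trans (le_of_eq ?_)
    rw [(PiLp.volume_preserving_ofLp (Fin (d + 1))).measure_preimage
      (MeasurableSet.univ_pi fun k => measurableSet_Ioo).nullMeasurableSet, Real.volume_pi_Ioo,
      Fin.prod_univ_castSucc]
    simp only [Fin.snoc_castSucc, Fin.snoc_last, sub_zero, finrank_euclideanSpace,
      Fintype.card_fin, Finset.prod_const, Finset.card_univ]
    rw [ENNReal.ofReal_mul (by positivity), ENNReal.ofReal_mul (by positivity),
      ENNReal.ofReal_pow (by positivity), ENNReal.ofReal_natCast, mul_assoc]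
    norm_num
  exact ENNReal.toReal_le_of_le_ofReal (by positivity) h2

/-- The points of the box have horizontal part of norm at least `1 / 2`, so projecting them to the
sphere at most doubles their height. -/
lemma vertexRegion_last_subset_lowerBand {d : ℕ} (hd : 0 < d) (s : ℝ) :
    vertexRegion d (Fin.last d) s ⊆ lowerBand d (2 * s) := by
  intro x hx
  refine ⟨vertexRegion_subset d _ s hx, ?_⟩
  obtain ⟨t, ht, hbox⟩ := hx
  have h1 := (abs_lt.1 (hbox.1 ⟨0, hd⟩)).2
  have h2 := simplexRadius_le_half d
  have h3 : ‖(t • (x : EuclideanSpace ℝ (Fin (d + 1)))) (Fin.castSucc ⟨0, hd⟩)‖ ≤ t := by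
    refine (PiLp.norm_apply_le _ _).trans (le_of_eq ?_)
    rw [norm_smul]
    simp [abs_of_pos ht]
  rw [Real.norm_eq_abs, abs_le] at h3
  simp only [simplexVertex, Fin.snoc_last, Pi.neg_apply, Pi.one_apply] at h1
  have ht2 : 1 / 2 ≤ t := by linarith [h3.1]
  have h4 := hbox.2.2
  have h5 := hbox.2.1
  simp only [PiLp.smul_apply, smul_eq_mul] at h4 h5
  have h6 : 0 < (x : EuclideanSpace ℝ (Fin (d + 1))) (Fin.last d) := by
    simpa [ht] using h5
  nlinarith

/-- The volume of the band of height `s` is at least proportional to `s`. -/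
lemma exists_le_sphereVol_lowerBand {d : ℕ} (hd : 0 < d) :
    ∃ c : ℝ, 0 < c ∧ ∀ s : ℝ, 0 ≤ s → s ≤ 1 → c * s ≤ (sphereVol d).real (lowerBand d s) := by
  obtain ⟨c, hc, h⟩ := exists_le_sphereVol_vertexRegion d
  refine ⟨c / 2, by positivity, fun s hs hs1 => ?_⟩
  have h1 := h (Fin.last d) (s / 2) (by linarith) (by linarith)
  have h2 := vertexRegion_last_subset_lowerBand hd (s / 2)
  rw [mul_div_cancel₀ s two_ne_zero] at h2
  linarith [measureReal_mono (μ := sphereVol d) h2]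

end Volume

/-! ### Measurability of the volume of the hull -/

/-- The volume of the spherical convex hull depends measurably on the points. -/
lemma measurable_sphereVol_sphericalHull (d : ℕ) (ι : Type*) [Fintype ι] [Nonempty ι] :
    Measurable fun y : ι → UnitSphere d => (sphereVol d).real (sphericalHull (Set.range y)) := by
  -- The graph is the projection of a closed, hence σ-compact, set of points and coefficients.
  set G : Set (((ι → UnitSphere d) × UnitSphere d) × (ι → ℝ)) :=
    {p | (∀ i, 0 ≤ p.2 i) ∧ (p.1.2 : EuclideanSpace ℝ (Fin (d + 1))) =
      ∑ i, p.2 i • (p.1.1 i : EuclideanSpace ℝ (Fin (d + 1)))} with hG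
  have hGc : IsClosed G := by
    have h1 : IsClosed {p : ((ι → UnitSphere d) × UnitSphere d) × (ι → ℝ) | ∀ i, 0 ≤ p.2 i} := by
      simp only [Set.ofPred_forall]
      exact isClosed_iInter fun i => isClosed_le continuous_const (by fun_prop)
    exact h1.inter (isClosed_eq (by fun_prop) (by fun_prop))
  have hmeas : MeasurableSet (Prod.fst '' G) := by
    obtain ⟨K, hK, hKG⟩ := (isSigmaCompact_univ.of_isClosed_subset hGc (Set.subset_univ _)).image
      (f := Prod.fst) continuous_fst
    rw [← hKG]
    exact MeasurableSet.iUnion fun n => (hK n).isClosed.measurableSet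
  have h := measurable_measure_prodMk_left (ν := sphereVol d) hmeas
  have heq : ∀ y : ι → UnitSphere d,
      sphericalHull (Set.range y) = Prod.mk y ⁻¹' (Prod.fst '' G) := by
    intro y
    ext x
    simp [mem_sphericalHull_range_iff, hG]
  simp only [heq]
  exact h.ennreal_toReal

/-! ### Variance and independence -/

/-- A random variable that takes values on both sides of a gap of length `g`, each with probability
at least `p`, has variance at least `p * g ^ 2 / 4`. -/
lemma mul_sq_div_four_le_variance {Ω : Type*} [MeasurableSpace Ω] {P : Measure Ω}
    [IsProbabilityMeasure P] {V : Ω → ℝ} (hV : MemLp V 2 P) {A B : Set Ω} {p a g : ℝ} (hg : 0 < g)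
    (hA : p ≤ P.real A) (hB : p ≤ P.real B) (hVA : ∀ ω ∈ A, V ω ≤ a)
    (hVB : ∀ ω ∈ B, a + g ≤ V ω) : p * g ^ 2 / 4 ≤ variance V P := by
  have hcheb : P.real {ω | g / 2 ≤ |V ω - P[V]|} ≤ variance V P / (g / 2) ^ 2 :=
    ENNReal.toReal_le_of_le_ofReal (div_nonneg (variance_nonneg _ _) (by positivity))
      (meas_ge_le_variance_div_sq hV (half_pos hg))
  -- The expectation is at distance at least `g / 2` from one side of the gap.
  have hp : p ≤ P.real {ω | g / 2 ≤ |V ω - P[V]|} := by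
    rcases le_total (a + g / 2) P[V] with h | h
    · refine hA.trans (measureReal_mono fun ω hω => ?_)
      have := hVA ω hω
      have : g / 2 ≤ -(V ω - P[V]) := by linarith
      exact this.trans (neg_le_abs _)
    · refine hB.trans (measureReal_mono fun ω hω => ?_)
      have := hVB ω hω
      have : g / 2 ≤ V ω - P[V] := by linarith
      exact this.trans (le_abs_self _)
  have := hp.trans hcheb
  rw [le_div_iff₀ (by positivity)] at this
  linarith

/-- Events that depend on disjoint groups of independent random variables are independent: here the
event for the group `B j` is that one of its members takes a value in `R j`. -/
lemma measureReal_forall_exists_mem_eq_prod {Ω β ι κ : Type*} [MeasurableSpace Ω]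
    [MeasurableSpace β] {P : Measure Ω} [IsProbabilityMeasure P] {X : ι → Ω → β}
    (hX : ∀ i, Measurable (X i)) (hind : iIndepFun X P) {B : κ → Finset ι}
    (hB : Pairwise fun j j' => Disjoint (B j) (B j')) {R : κ → Set β}
    (hR : ∀ j, MeasurableSet (R j)) (J : Finset κ) :
    P.real {ω | ∀ j ∈ J, ∃ i ∈ B j, X i ω ∈ R j} =
      ∏ j ∈ J, P.real {ω | ∃ i ∈ B j, X i ω ∈ R j} := by
  classical
  induction J using Finset.induction_on with
  | empty => simp
  | insert j₀ J hj₀ ih =>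
    rw [Finset.prod_insert hj₀, ← ih]
    have hdisj : Disjoint (B j₀) (J.biUnion B) := by
      rw [Finset.disjoint_biUnion_right]
      intro j hj
      exact hB (fun h => hj₀ (h ▸ hj))
    have hI := hind.indepFun_finset (B j₀) (J.biUnion B) hdisj hX
    have h1 : MeasurableSet {y : B j₀ → β | ∃ i, y i ∈ R j₀} := by
      rw [Set.ofPred_exists]
      exact MeasurableSet.iUnion fun i => measurable_pi_apply i (hR j₀)
    have h2 : MeasurableSet {y : J.biUnion B → β |
        ∀ j ∈ J, ∃ i : J.biUnion B, (i : ι) ∈ B j ∧ y i ∈ R j} := by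
      simp only [Set.ofPred_forall, Set.ofPred_exists, Set.ofPred_and]
      refine Finset.measurableSet_biInter _ fun j _ => MeasurableSet.iUnion fun i => ?_
      exact (MeasurableSet.const _).inter (measurable_pi_apply i (hR j))
    have h := hI.measure_inter_preimage_eq_mul _ _ h1 h2
    rw [measureReal_def, measureReal_def, measureReal_def, ← ENNReal.toReal_mul]
    congr 1
    convert h using 2
    · ext ω
      simp only [Set.mem_ofPred_eq, Finset.forall_mem_insert, Set.mem_inter_iff, Set.mem_preimage,
        Subtype.exists, Finset.mem_biUnion]
      refine and_congr (by simp) (forall₂_congr fun j hj => ?_)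
      constructor
      · rintro ⟨i, hi, hx⟩
        exact ⟨i, ⟨j, hj, hi⟩, hi, hx⟩
      · rintro ⟨i, -, hi, hx⟩
        exact ⟨i, hi, hx⟩
    · congr 1
      ext ω
      simp
    · congr 1
      ext ω
      simp only [Set.mem_ofPred_eq, Set.mem_preimage, Subtype.exists, Finset.mem_biUnion]
      refine forall₂_congr fun j hj => ?_
      constructor
      · rintro ⟨i, hi, hx⟩
        exact ⟨i, ⟨j, hj, hi⟩, hi, hx⟩
      · rintro ⟨i, -, hi, hx⟩
        exact ⟨i, hi, hx⟩

lemma measureReal_forall_mem_eq_prod {Ω β ι : Type*} [MeasurableSpace Ω]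
    [MeasurableSpace β] {P : Measure Ω} {X : ι → Ω → β} (hind : iIndepFun X P) (B : Finset ι)
    {T : Set β} (hT : MeasurableSet T) :
    P.real {ω | ∀ i ∈ B, X i ω ∈ T} = ∏ i ∈ B, P.real (X i ⁻¹' T) := by
  have h := hind.measure_inter_preimage_eq_mul B (sets := fun _ => T) fun _ _ => hT
  have hset : {ω | ∀ i ∈ B, X i ω ∈ T} = ⋂ i ∈ B, X i ⁻¹' T := by
    ext ω; simp
  simp only [measureReal_def]
  rw [hset, h, ENNReal.toReal_prod]

/-- At least `m` independent trials, each of success probability at least `p`, succeed at least once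
with probability at least `1 - exp (-(m * p))`. -/
lemma one_sub_exp_le_measureReal_exists_mem {Ω β ι : Type*} [MeasurableSpace Ω]
    [MeasurableSpace β] {P : Measure Ω} [IsProbabilityMeasure P] {X : ι → Ω → β}
    (hX : ∀ i, Measurable (X i)) (hind : iIndepFun X P) {B : Finset ι} {R : Set β}
    (hR : MeasurableSet R) {p : ℝ} (hp : 0 ≤ p) (hpX : ∀ i, p ≤ P.real (X i ⁻¹' R)) {m : ℕ}
    (hm : m ≤ B.card) : 1 - Real.exp (-(m * p)) ≤ P.real {ω | ∃ i ∈ B, X i ω ∈ R} := by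
  have hcompl : {ω | ∃ i ∈ B, X i ω ∈ R} = {ω | ∀ i ∈ B, X i ω ∈ Rᶜ}ᶜ := by
    ext ω; simp
  have hmeas : MeasurableSet {ω | ∀ i ∈ B, X i ω ∈ Rᶜ} := by
    simp only [Set.ofPred_forall]
    exact Finset.measurableSet_biInter _ fun i _ => hX i hR.compl
  rw [hcompl, probReal_compl_eq_one_sub hmeas, measureReal_forall_mem_eq_prod hind B hR.compl]
  gcongr
  calc ∏ i ∈ B, P.real (X i ⁻¹' Rᶜ) ≤ ∏ _i ∈ B, Real.exp (-p) := by
        refine Finset.prod_le_prod (fun i _ => measureReal_nonneg) fun i _ => ?_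
        rw [Set.preimage_compl, probReal_compl_eq_one_sub (hX i hR)]
        linarith [hpX i, Real.one_sub_le_exp_neg p]
    _ = Real.exp (-(B.card * p)) := by
        rw [Finset.prod_const, ← Real.exp_nat_mul]
        ring_nf
    _ ≤ Real.exp (-(m * p)) := by gcongr

/-! ### Uniform points in the hemisphere -/

lemma sphereVol_real_le_last {d : ℕ} {s : ℝ} (hs : 0 < s) :
    (sphereVol d).real {x | s ≤ (x : EuclideanSpace ℝ (Fin (d + 1))) (Fin.last d)} =
      (sphereVol d).real (upperHemisphere d) - (sphereVol d).real (lowerBand d s) := by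
  rw [← measureReal_sdiff (lowerBand_subset d s) (isOpen_lowerBand d s).measurableSet]
  congr 1
  ext x
  simp only [Set.mem_ofPred_eq, Set.mem_sdiff, upperHemisphere, lowerBand, not_and, not_lt]
  exact ⟨fun h => ⟨hs.trans_le h, fun _ => h⟩, fun h => h.2 h.1⟩

lemma upperHemisphere_pos {d : ℕ} (hd : 0 < d) : 0 < (sphereVol d).real (upperHemisphere d) := by
  obtain ⟨c, hc, h⟩ := exists_le_sphereVol_lowerBand hd
  have := h 1 zero_le_one le_rfl
  linarith [measureReal_mono (μ := sphereVol d) (lowerBand_subset d 1)]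

lemma measureReal_preimage_of_isUniform {d : ℕ} (hd : 0 < d) {Ω : Type*} [MeasurableSpace Ω]
    {P : Measure Ω} {X : Ω → UnitSphere d}
    (hX : pdf.IsUniform X (upperHemisphere d) P (sphereVol d)) {A : Set (UnitSphere d)}
    (hA : MeasurableSet A) (hAH : A ⊆ upperHemisphere d) :
    P.real (X ⁻¹' A) = (sphereVol d).real A / (sphereVol d).real (upperHemisphere d) := by
  have h0 : sphereVol d (upperHemisphere d) ≠ 0 := fun h =>
    (upperHemisphere_pos hd).ne' (by rw [measureReal_def, h, ENNReal.toReal_zero])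
  rw [measureReal_def, hX.measure_preimage h0 (measure_ne_top _ _) hA,
    Set.inter_eq_self_of_subset_right hAH, ENNReal.toReal_div]
  rfl

/-- With probability at least one half, no point lies below a small multiple of `1 / n`. -/
lemma half_le_measureReal_forall_le_last {d : ℕ} (hd : 0 < d) {C δ : ℝ} (hδ : 0 < δ)
    (hC : ∀ s : ℝ, 0 ≤ s → (sphereVol d).real (lowerBand d s) ≤ C * s)
    (hCδ : C * δ ≤ (sphereVol d).real (upperHemisphere d) / 2) {n : ℕ} (hn : 0 < n) {Ω : Type*}
    [MeasurableSpace Ω] {P : Measure Ω} {X : Fin n → Ω → UnitSphere d} (hind : iIndepFun X P)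
    (hX : ∀ i, pdf.IsUniform (X i) (upperHemisphere d) P (sphereVol d)) :
    1 / 2 ≤ P.real {ω | ∀ i, δ / n ≤ (X i ω : EuclideanSpace ℝ (Fin (d + 1))) (Fin.last d)} := by
  have hH := upperHemisphere_pos hd
  have hn' : (0 : ℝ) < n := by exact_mod_cast hn
  set h := (sphereVol d).real (upperHemisphere d) with hh
  have hT : MeasurableSet {x : UnitSphere d |
      δ / n ≤ (x : EuclideanSpace ℝ (Fin (d + 1))) (Fin.last d)} :=
    (isClosed_le continuous_const (continuous_unitSphere_apply _)).measurableSet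
  have hprod := measureReal_forall_mem_eq_prod hind Finset.univ hT
  simp only [Finset.mem_univ, true_imp_iff, Set.mem_ofPred_eq] at hprod
  rw [hprod]
  have hb := hC (δ / n) (by positivity)
  have hterm : ∀ i, 1 - 1 / 2 / (n : ℝ) ≤
      P.real (X i ⁻¹' {x | δ / n ≤ (x : EuclideanSpace ℝ (Fin (d + 1))) (Fin.last d)}) := by
    intro i
    rw [measureReal_preimage_of_isUniform hd (hX i) hT fun x hx =>
      (show 0 < δ / n by positivity).trans_le hx, sphereVol_real_le_last (by positivity), ← hh,
      le_div_iff₀ hH]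
    have h1 : C * (δ / n) ≤ h / 2 / n := by
      rw [← mul_div_assoc]
      gcongr
    have h2 : (1 - 1 / 2 / (n : ℝ)) * h = h - h / 2 / n := by ring
    linarith
  have hn1 : (1 : ℝ) ≤ n := by exact_mod_cast hn
  have hbase : 1 / 2 / (n : ℝ) ≤ 1 := by
    rw [div_le_one hn']
    linarith
  calc (1 / 2 : ℝ) = 1 + n * (-(1 / 2 / (n : ℝ))) := by field_simp; norm_num
    _ ≤ (1 + -(1 / 2 / (n : ℝ))) ^ n := one_add_mul_le_pow (by linarith) n
    _ = ∏ _i : Fin n, (1 - 1 / 2 / (n : ℝ)) := by simp [sub_eq_add_neg]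
    _ ≤ _ := Finset.prod_le_prod (fun i _ => by linarith) fun i _ => hterm i

/-- With probability bounded away from `0`, every region near a vertex of the simplex and of height
of order `1 / n` contains one of the points. The `d + 1` regions are served by disjoint groups of
`n / (d + 1)` points each. -/
lemma pow_le_measureReal_forall_exists_mem_vertexRegion {d : ℕ} (hd : 0 < d) {c ε : ℝ} (hc : 0 < c)
    (hε : 0 < ε) (hε1 : ε ≤ 1)
    (hcR : ∀ j, ∀ s : ℝ, 0 ≤ s → s ≤ 1 → c * s ≤ (sphereVol d).real (vertexRegion d j s)) {n : ℕ}
    (hn : d + 1 ≤ n) {Ω : Type*} [MeasurableSpace Ω] {P : Measure Ω} [IsProbabilityMeasure P]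
    {X : Fin n → Ω → UnitSphere d} (hXm : ∀ i, Measurable (X i)) (hind : iIndepFun X P)
    (hX : ∀ i, pdf.IsUniform (X i) (upperHemisphere d) P (sphereVol d)) :
    (1 - Real.exp (-(c * ε / (sphereVol d).real (upperHemisphere d) / (2 * (d + 1))))) ^ (d + 1) ≤
      P.real {ω | ∀ j, ∃ i, X i ω ∈ vertexRegion d j (ε / n)} := by
  have hH := upperHemisphere_pos hd
  have hn' : (0 : ℝ) < n := by
    have : 0 < n := by omega
    exact_mod_cast this
  have hn1 : (1 : ℝ) ≤ n := by
    have : 1 ≤ n := by omega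
    exact_mod_cast this
  set h := (sphereVol d).real (upperHemisphere d) with hh
  set m := n / (d + 1) with hm
  have hm0 : 0 < m := Nat.div_pos hn (by omega)
  have hmn : (d + 1) * m ≤ n := Nat.mul_div_le n (d + 1)
  have hnm : n < 2 * (d + 1) * m := by
    have h1 : n < (d + 1) * (m + 1) := Nat.lt_mul_div_succ n (by omega)
    nlinarith
  set B : Fin (d + 1) → Finset (Fin n) := fun j => {i | (i : ℕ) / m = j} with hB
  have hBdisj : Pairwise fun j j' => Disjoint (B j) (B j') := by
    intro j j' hjj'
    rw [Finset.disjoint_left]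
    intro i hi hi'
    simp only [hB, Finset.mem_filter, Finset.mem_univ, true_and] at hi hi'
    exact hjj' (Fin.ext (hi.symm.trans hi'))
  have hBcard : ∀ j, m ≤ (B j).card := by
    intro j
    have hlt : ∀ l : Fin m, m * j + l < n := fun l => by
      have h1 : m * ((j : ℕ) + 1) ≤ m * (d + 1) := Nat.mul_le_mul_left m j.2
      have := l.2
      nlinarith
    have := Finset.card_le_card_of_injOn (s := (Finset.univ : Finset (Fin m))) (t := B j)
      (fun l => ⟨m * j + l, hlt l⟩) (fun l _ => by
        simp [hB, Nat.mul_add_div hm0, Nat.div_eq_of_lt l.2])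
      (fun l _ l' _ hll' => by
        simpa [Fin.ext_iff] using hll')
    simpa using this
  have hRm : ∀ j, MeasurableSet (vertexRegion d j (ε / n)) :=
    fun j => (isOpen_vertexRegion d j _).measurableSet
  set p := c * (ε / n) / h with hp
  have hpX : ∀ j i, p ≤ P.real (X i ⁻¹' vertexRegion d j (ε / n)) := by
    intro j i
    rw [measureReal_preimage_of_isUniform hd (hX i) (hRm j) (vertexRegion_subset d j _), ← hh]
    have := hcR j (ε / n) (by positivity) ((div_le_one hn').2 (hε1.trans hn1))
    rw [hp]
    gcongr
  have hmp : c * ε / h / (2 * (d + 1)) ≤ m * p := by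
    have h1 : (n : ℝ) ≤ 2 * (d + 1) * m := by exact_mod_cast hnm.le
    have h2 : m * p = c * ε / h * (m / n) := by rw [hp]; ring
    rw [h2, div_eq_mul_inv]
    gcongr
    rw [inv_le_iff_one_le_mul₀ (by positivity), mul_comm, ← mul_div_assoc, one_le_div hn']
    exact h1
  have hprod := measureReal_forall_exists_mem_eq_prod hXm hind hBdisj hRm Finset.univ
  calc (1 - Real.exp (-(c * ε / h / (2 * (d + 1))))) ^ (d + 1)
      = ∏ _j : Fin (d + 1), (1 - Real.exp (-(c * ε / h / (2 * (d + 1))))) := by simp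
    _ ≤ ∏ j, P.real {ω | ∃ i ∈ B j, X i ω ∈ vertexRegion d j (ε / n)} := by
        refine Finset.prod_le_prod (fun j _ => ?_) fun j _ => ?_
        · rw [sub_nonneg, Real.exp_le_one_iff, neg_nonpos]
          positivity
        · refine le_trans ?_ (one_sub_exp_le_measureReal_exists_mem hXm hind (hRm j)
            (by positivity) (hpX j) (hBcard j))
          gcongr
    _ ≤ _ := by
        rw [← hprod]
        refine measureReal_mono fun ω hω j => ?_
        obtain ⟨i, -, hi⟩ := hω j (Finset.mem_univ j)
        exact ⟨i, hi⟩

theorem corollary1p2 (d : ℕ) (hd : 2 ≤ d) :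
    ∃ γ : ℝ, 0 < γ ∧
      ∀ n : ℕ, d + 1 ≤ n →
        ∀ (Ω : Type*) [MeasurableSpace Ω] (P : Measure Ω) [IsProbabilityMeasure P]
          (X : Fin n → Ω → UnitSphere d),
          (∀ i, Measurable (X i)) →
          iIndepFun X P →
          (∀ i, pdf.IsUniform (X i) (upperHemisphere d) P (sphereVol d)) →
          MemLp (fun ω => (sphereVol d).real (sphericalHull (Set.range fun i => X i ω))) 2 P ∧
          γ * ((n : ℝ) ^ 2)⁻¹ ≤
            variance (fun ω => (sphereVol d).real (sphericalHull (Set.range fun i => X i ω))) P := by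
  have hd0 : 0 < d := by omega
  have hH := upperHemisphere_pos hd0
  have hρ := simplexRadius_pos d
  obtain ⟨C, hC, hCb⟩ := exists_sphereVol_lowerBand_le d
  obtain ⟨c, hc, hcb⟩ := exists_le_sphereVol_lowerBand hd0
  obtain ⟨c', hc', hcR⟩ := exists_le_sphereVol_vertexRegion d
  set h := (sphereVol d).real (upperHemisphere d) with hh
  obtain ⟨δ, hδ, hδ1, hCδ⟩ : ∃ δ : ℝ, 0 < δ ∧ δ ≤ 1 ∧ C * δ ≤ h / 2 :=
    ⟨min 1 (h / 2 / C), by positivity, min_le_left _ _,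
      (mul_le_mul_of_nonneg_left (min_le_right _ _) hC.le).trans_eq (mul_div_cancel₀ _ hC.ne')⟩
  -- The choice of `ε` makes the volume lost in the second event at most half of that lost in the
  -- first one.
  obtain ⟨ε, hε, hε1, hCε⟩ :
      ∃ ε : ℝ, 0 < ε ∧ ε ≤ 1 ∧ C * ε / simplexRadius d ≤ c * δ / 2 := by
    refine ⟨min 1 (c * δ / 2 * simplexRadius d / C), by positivity, min_le_left _ _, ?_⟩
    rw [div_le_iff₀ hρ]
    exact (mul_le_mul_of_nonneg_left (min_le_right _ _) hC.le).trans_eq (mul_div_cancel₀ _ hC.ne')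
  set p := min (1 / 2) ((1 - Real.exp (-(c' * ε / h / (2 * (d + 1))))) ^ (d + 1)) with hp
  have hp0 : 0 < p := by
    refine lt_min (by norm_num) (pow_pos ?_ _)
    rw [sub_pos, Real.exp_lt_one_iff, neg_lt_zero]
    positivity
  refine ⟨p * (c * δ / 2) ^ 2 / 4, by positivity, fun n hn Ω _ P _ X hXm hind hX => ?_⟩
  have hn0 : 0 < n := by omega
  have hn' : (0 : ℝ) < n := by exact_mod_cast hn0
  have hn1 : (1 : ℝ) ≤ n := by exact_mod_cast hn0
  have : Nonempty (Fin n) := ⟨⟨0, hn0⟩⟩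
  have hmem : MemLp (fun ω => (sphereVol d).real (sphericalHull (Set.range fun i => X i ω))) 2 P := by
    refine MemLp.of_bound ((measurable_sphereVol_sphericalHull d (Fin n)).comp
      (measurable_pi_lambda (fun ω i => X i ω) hXm)).aestronglyMeasurable
      ((sphereVol d).real Set.univ) (Filter.Eventually.of_forall fun ω => ?_)
    rw [Real.norm_eq_abs, abs_of_nonneg measureReal_nonneg]
    exact measureReal_mono (Set.subset_univ _)
  refine ⟨hmem, ?_⟩
  have key := mul_sq_div_four_le_variance hmem (p := p) (a := h - c * (δ / n))
    (g := c * δ / 2 / n) (by positivity)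
    ((min_le_left _ _).trans (half_le_measureReal_forall_le_last hd0 hδ hCb hCδ hn0 hind hX))
    ((min_le_right _ _).trans (pow_le_measureReal_forall_exists_mem_vertexRegion hd0 hc' hε hε1 hcR
      hn hXm hind hX)) ?_ ?_
  · refine le_trans (le_of_eq ?_) key
    field_simp
  · intro ω hω
    have hs : 0 < δ / n := by positivity
    have h1 : (sphereVol d).real (sphericalHull (Set.range fun i => X i ω)) ≤
        (sphereVol d).real {x | δ / n ≤ (x : EuclideanSpace ℝ (Fin (d + 1))) (Fin.last d)} :=
      measureReal_mono fun x hx => le_last_of_mem_sphericalHull hs.le hω hx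
    rw [sphereVol_real_le_last hs] at h1
    have h2 := hcb (δ / n) hs.le ((div_le_one hn').2 (hδ1.trans hn1))
    linarith
  · intro ω hω
    have hs : 0 < ε / n / simplexRadius d := by positivity
    have h1 : (sphereVol d).real
          {x | ε / n / simplexRadius d ≤ (x : EuclideanSpace ℝ (Fin (d + 1))) (Fin.last d)} ≤
        (sphereVol d).real (sphericalHull (Set.range fun i => X i ω)) :=
      measureReal_mono fun x hx => mem_sphericalHull_of_vertexRegion hω hx
    rw [sphereVol_real_le_last hs] at h1
    have h2 := hCb _ hs.le
    have h3 : C * (ε / n / simplexRadius d) ≤ c * δ / 2 / n := by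
      calc C * (ε / n / simplexRadius d) = C * ε / simplexRadius d / n := by ring
        _ ≤ _ := by gcongr
    have h4 : c * (δ / n) = c * δ / 2 / n + c * δ / 2 / n := by ring
    linarith
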